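/- Let $B$ and $Y$ be Banach spaces, both linear subspaces of a common vector space (no continuous embedding between them is assumed), and let $T>0$. Let $M_+$ be a seminormed nonnegative cone in $B$, that is, $M_+\subset B$, $cu\in M_+$ for all $u\in M_+$ and $c\ge 0$, and there is a function $[\cdot]:M_+\to[0,\infty)$ such that $[u]=0$ if and only if $u=0$, and $[cu]=c[u]$ for all $u\in M_+$ and $c\ge 0$. Let either $1\le p<\infty$ and $r=1$, or $p=\infty$ and $1<r\le\infty$. Assume: (i) $M_+\hookrightarrow B$ compactly: every sequence $(u_n)\subset M_+$ for which $([u_n])$ is bounded has a subsequence converging in $B$. (ii) If $(w_n)\subset B\cap Y$, $w_n\to w$ in $B$ and $w_n\to 0$ in $Y$ as $n\to\infty$, then $w=0$. (iii) $U\subset L^p(0,T;M_+\cap Y)$ is bounded in $L^p(0,T;M_+)$. That is, every $u\in U$ belongs to $L^p(0,T;B)$ and to $L^p(0,T;Y)$, $u(t)\in M_+$ for almost every $t\in(0,T)$, the function $t\mapsto[u(t)]$ belongs to $L^p(0,T)$, and $\sup_{u\in U}\|[u(\cdot)]\|_{L^p(0,T)}<\infty$. (iv) $\partial U/\partial t$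 is bounded in $L^r(0,T;Y)$: every $u\in U$ has a distributional time derivative $\partial u/\partial t\in L^r(0,T;Y)$, and $\sup_{u\in U}\|\partial u/\partial t\|_{L^r(0,T;Y)}<\infty$. Then $U$ is relatively compact in $L^p(0,T;B)$. If $p=\infty$, then moreover every $u\in U$ has a representative in $C([0,T];B)$, and the set of these representatives is relatively compact in $C([0,T];B)$. -/

import Mathlib

open MeasureTheory Set Filter Topology
open scoped ENNReal NNReal ContDiff

noncomputable section

namespace AubinLions

/-- Lebesgue measure on the time interval `(0, T)`. -/
abbrev timeMeasure (T : ℝ) : Measure ℝ := volume.restrict (Ioo 0 T)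

/-- A seminormed nonnegative cone in `B`: a subset stable under multiplication by nonnegative
reals, with a nonnegative, positively homogeneous and definite function `gauge` on it (no triangle
inequality, no convexity).  The values of `gauge` off `carrier` play no role. -/
structure SeminormedCone (B : Type*) [NormedAddCommGroup B] [NormedSpace ℝ B] where
  carrier : Set B
  smul_mem : ∀ u ∈ carrier, ∀ c : ℝ, 0 ≤ c → c • u ∈ carrier
  gauge : B → ℝ
  gauge_nonneg : ∀ u ∈ carrier, 0 ≤ gauge u
  gauge_eq_zero_iff : ∀ u ∈ carrier, (gauge u = 0 ↔ u = 0)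
  gauge_smul : ∀ u ∈ carrier, ∀ c : ℝ, 0 ≤ c → gauge (c • u) = c * gauge u

section Cone

variable {B : Type*} [NormedAddCommGroup B] [NormedSpace ℝ B]

/-- `M ↪ B` compactly: every bounded sequence in `M` has a subsequence converging in `B`. -/
def SeminormedCone.CompactlyEmbedded (M : SeminormedCone B) : Prop :=
  ∀ u : ℕ → B, (∀ n, u n ∈ M.carrier) → (∃ C : ℝ, ∀ n, M.gauge (u n) ≤ C) →
    ∃ φ : ℕ → ℕ, StrictMono φ ∧ ∃ b : B, Tendsto (fun n => u (φ n)) atTop (𝓝 b)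

/-- `u ∈ L^p(0,T;M)`: the function `u ∈ L^p(0,T;B)` has values in `M` almost everywhere, and
`t ↦ [u(t)]` belongs to `L^p(0,T)`. -/
def SeminormedCone.MemLpCone (M : SeminormedCone B) {p : ℝ≥0∞} {T : ℝ}
    (u : Lp B p (timeMeasure T)) : Prop :=
  (∀ᵐ t ∂timeMeasure T, u t ∈ M.carrier) ∧ MemLp (fun t => M.gauge (u t)) p (timeMeasure T)

/-- `U` is a bounded subset of `L^p(0,T;M)`. -/
def SeminormedCone.BoundedInLpCone (M : SeminormedCone B) {p : ℝ≥0∞} {T : ℝ}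
    (U : Set (Lp B p (timeMeasure T))) : Prop :=
  ∃ C : ℝ≥0, ∀ u ∈ U,
    M.MemLpCone u ∧ eLpNorm (fun t => M.gauge (u t)) p (timeMeasure T) ≤ C

end Cone

section Couple

/-! `B` and `Y` are linear subspaces of a common vector space `E`, through the injective linear maps
`ιB` and `ιY`; thus `b : B` and `y : Y` are the same vector when `ιB b = ιY y`. -/

variable {B Y E : Type*} [NormedAddCommGroup B] [NormedSpace ℝ B]
  [NormedAddCommGroup Y] [NormedSpace ℝ Y] [AddCommGroup E] [Module ℝ E]

/-- If `w_n → w` in `B` and `w_n → 0` in `Y`, then `w = 0`. -/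
def LimitCompatible (ιB : B →ₗ[ℝ] E) (ιY : Y →ₗ[ℝ] E) : Prop :=
  ∀ (b : ℕ → B) (y : ℕ → Y) (w : B), (∀ n, ιB (b n) = ιY (y n)) →
    Tendsto b atTop (𝓝 w) → Tendsto y atTop (𝓝 0) → w = 0

/-- The `B`-valued function `u` and the `Y`-valued function `v` on `(0, T)` are the same function
almost everywhere. -/
def SameFunction (ιB : B →ₗ[ℝ] E) (ιY : Y →ₗ[ℝ] E) {p q : ℝ≥0∞} {T : ℝ}
    (u : Lp B p (timeMeasure T)) (v : Lp Y q (timeMeasure T)) : Prop :=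
  ∀ᵐ t ∂timeMeasure T, ιB (u t) = ιY (v t)

/-- `v'` is the derivative of `v` in the sense of `Y`-valued distributions on `(0, T)`. -/
def HasWeakTimeDeriv {q r : ℝ≥0∞} {T : ℝ}
    (v : Lp Y q (timeMeasure T)) (v' : Lp Y r (timeMeasure T)) : Prop :=
  ∀ φ : ℝ → ℝ, ContDiff ℝ ∞ φ → HasCompactSupport φ → tsupport φ ⊆ Ioo 0 T →
    ∫ t in Ioo 0 T, deriv φ t • v t = -∫ t in Ioo 0 T, φ t • v' t

/-- `∂U/∂t` is bounded in `L^r(0,T;Y)`. -/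
def BoundedTimeDeriv (ιB : B →ₗ[ℝ] E) (ιY : Y →ₗ[ℝ] E) {p : ℝ≥0∞} {T : ℝ}
    (U : Set (Lp B p (timeMeasure T))) (r : ℝ≥0∞) : Prop :=
  ∃ C : ℝ, ∀ u ∈ U, ∃ v : Lp Y p (timeMeasure T), SameFunction ιB ιY u v ∧
    ∃ v' : Lp Y r (timeMeasure T), HasWeakTimeDeriv v v' ∧ ‖v'‖ ≤ C

end Couple

section Continuous

variable {B : Type*} [NormedAddCommGroup B]

/-- `f ∈ C([0,T];B)` is a representative of the class `u`. -/
def IsContinuousRep {p : ℝ≥0∞} {T : ℝ} (u : Lp B p (timeMeasure T)) (f : C(Icc (0 : ℝ) T, B)) :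
    Prop :=
  ∀ᵐ t ∂timeMeasure T, ∀ ht : t ∈ Icc (0 : ℝ) T, f ⟨t, ht⟩ = u t

/-- `U` is a relatively compact subset of `C([0,T];B)`: each of its elements has a continuous
representative, and the set of these representatives has compact closure for uniform
convergence. -/
def RelativelyCompactInC {p : ℝ≥0∞} {T : ℝ} (U : Set (Lp B p (timeMeasure T))) : Prop :=
  (∀ u ∈ U, ∃ f : C(Icc (0 : ℝ) T, B), IsContinuousRep u f) ∧
    IsCompact (closure {f : C(Icc (0 : ℝ) T, B) | ∃ u ∈ U, IsContinuousRep u f})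

end Continuous

end AubinLions

end

/-! Integrating the distributional derivative, each `u ∈ U` has, off a null set, increments
`u t - u s` which lie in `Y` with norm at most `∫_s^t ‖∂u/∂t‖_Y`.  Compactness of `M ↪ B` and
condition (ii) give Ehrling's inequality `‖a - b‖_B ≤ ε ([a] + [b]) + C_ε ‖a - b‖_Y` on the cone: a
violation by elements with `[a], [b] ≤ 1` is excluded by extracting limits, and homogeneity of the
gauge reduces the general case to this one by dividing by `[a] + [b]`.

Cut `(0, T)` into equal cells and pick in every cell a point at which the gauge of `u` is at most
its `L^p`-mean over the cell.  The step function through these points takes values in a fixed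
compact subset of `B`, and by Ehrling's inequality its `L^p`-distance to `u` is at most
`2 ε ‖[u]‖_p` plus `C_ε` times the `L^p`-norm of the integral of `‖∂u/∂t‖_Y` over the cell, which
tends to zero with the cell length, uniformly in `u ∈ U`.  Hence `U` is totally bounded.

For `p = ∞` Ehrling's inequality makes `u` uniformly continuous off a null set, whence the
continuous representative; since `C([0,T];B)` is a closed subspace of `L^∞(0,T;B)`, compactness
passes to it. -/

namespace AubinLions

section WeakDeriv

variable {Y : Type*} [NormedAddCommGroup Y] [NormedSpace ℝ Y] {a b : ℝ}

/-- Test functions on the interval `(a, b)`, as functions on the whole line. -/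
structure IsTestFunctionOn (a b : ℝ) (φ : ℝ → ℝ) : Prop where
  contDiff : ContDiff ℝ ∞ φ
  hasCompactSupport : HasCompactSupport φ
  tsupport_subset : tsupport φ ⊆ Ioo a b

/-- `v'` is the derivative of `v` in the sense of distributions on `(a, b)`. -/
def HasWeakDerivOn (a b : ℝ) (v v' : ℝ → Y) : Prop :=
  ∀ φ : ℝ → ℝ, IsTestFunctionOn a b φ →
    ∫ t in Ioo a b, deriv φ t • v t = -∫ t in Ioo a b, φ t • v' t

namespace IsTestFunctionOn

variable {φ ψ : ℝ → ℝ}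

lemma eq_zero_of_notMem (hφ : IsTestFunctionOn a b φ) {t : ℝ} (ht : t ∉ Ioo a b) : φ t = 0 :=
  image_eq_zero_of_notMem_tsupport fun h => ht (hφ.tsupport_subset h)

lemma setIntegral_eq_integral (hφ : IsTestFunctionOn a b φ) :
    ∫ t in Ioo a b, φ t = ∫ t, φ t :=
  setIntegral_eq_integral_of_forall_compl_eq_zero fun _ ht => hφ.eq_zero_of_notMem ht

lemma sub_const_mul (hφ : IsTestFunctionOn a b φ) (hψ : IsTestFunctionOn a b ψ) (c : ℝ) :
    IsTestFunctionOn a b fun t => φ t - c * ψ t where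
  contDiff := hφ.contDiff.sub (contDiff_const.mul hψ.contDiff)
  hasCompactSupport := hφ.hasCompactSupport.sub hψ.hasCompactSupport.mul_left
  tsupport_subset := (tsupport_sub _ _).trans
    (union_subset hφ.tsupport_subset (tsupport_mul_subset_right.trans hψ.tsupport_subset))

lemma integrable_smul (hφ : IsTestFunctionOn a b φ) {w : ℝ → Y} (hw : IntegrableOn w (Ioo a b)) :
    IntegrableOn (fun t => φ t • w t) (Ioo a b) := by
  obtain ⟨C, hC⟩ := hφ.hasCompactSupport.exists_bound_of_continuous hφ.contDiff.continuous
  exact hw.bdd_smul C hφ.contDiff.continuous.aestronglyMeasurable (Eventually.of_forall hC)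

lemma deriv (hφ : IsTestFunctionOn a b φ) : IsTestFunctionOn a b (deriv φ) where
  contDiff := (contDiff_infty_iff_deriv.1 hφ.contDiff).2
  hasCompactSupport := hφ.hasCompactSupport.deriv
  tsupport_subset := tsupport_deriv_subset.trans hφ.tsupport_subset

end IsTestFunctionOn

lemma exists_isTestFunctionOn_integral_eq_one (hab : a < b) :
    ∃ η : ℝ → ℝ, IsTestFunctionOn a b η ∧ ∫ t, η t = 1 := by
  let f : ContDiffBump ((a + b) / 2) := ⟨(b - a) / 8, (b - a) / 4, by linarith, by linarith⟩
  refine ⟨f.normed volume, ⟨f.contDiff_normed, f.hasCompactSupport_normed, ?_⟩,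
    f.integral_normed⟩
  rw [f.tsupport_normed_eq, Real.closedBall_eq_Icc]
  exact Icc_subset_Ioo (by simp only [f]; linarith) (by simp only [f]; linarith)

lemma IsTestFunctionOn.exists_deriv_eq {ψ : ℝ → ℝ} (hψ : IsTestFunctionOn a b ψ)
    (hψ0 : ∫ t, ψ t = 0) : ∃ φ, IsTestFunctionOn a b φ ∧ _root_.deriv φ = ψ := by
  rcases (tsupport ψ).eq_empty_or_nonempty with hempty | hne
  · refine ⟨ψ, hψ, ?_⟩
    rw [tsupport_eq_empty_iff.1 hempty, deriv_zero]
  obtain ⟨y, hy, hyψ⟩ := hψ.hasCompactSupport.isCompact.exists_isLeast hne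
  obtain ⟨z, hz, hzψ⟩ := hψ.hasCompactSupport.isCompact.exists_isGreatest hne
  set φ : ℝ → ℝ := fun x => ∫ t in a..x, ψ t
  have hsupport : Function.support φ ⊆ Icc y z := by
    refine fun x hx => ⟨?_, ?_⟩ <;> contrapose! hx
    · refine Function.notMem_support.2
        (intervalIntegral.integral_zero_ae (Eventually.of_forall fun t ht => ?_))
      refine image_eq_zero_of_notMem_tsupport fun htψ => (hyψ htψ).not_gt ?_
      exact ht.2.trans_lt (max_lt (hψ.tsupport_subset hy).1 hx)
    · refine Function.notMem_support.2
        ((intervalIntegral.integral_eq_integral_of_support_subset fun t ht => ?_).trans hψ0)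
      have htψ := subset_tsupport ψ ht
      exact ⟨(hψ.tsupport_subset htψ).1, (hzψ htψ).trans hx.le⟩
  have hderiv : ∀ x, HasDerivAt φ (ψ x) x := fun x =>
    (hψ.contDiff.continuous.integral_hasStrictDerivAt a x).hasDerivAt
  have hdφ : _root_.deriv φ = ψ := funext fun x => (hderiv x).deriv
  exact ⟨φ,
    { contDiff := contDiff_infty_iff_deriv.2
        ⟨fun x => (hderiv x).differentiableAt, hdφ ▸ hψ.contDiff⟩
      hasCompactSupport := HasCompactSupport.of_support_subset_isCompact isCompact_Icc hsupport
      tsupport_subset := (closure_minimal hsupport isClosed_Icc).trans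
        (ordConnected_Ioo.out (hψ.tsupport_subset hy) (hψ.tsupport_subset hz)) }, hdφ⟩

/-- The du Bois-Reymond lemma. -/
lemma exists_ae_eq_const_of_hasWeakDerivOn_zero [CompleteSpace Y] (hab : a < b) {w : ℝ → Y}
    (hw : IntegrableOn w (Ioo a b)) (hw' : HasWeakDerivOn a b w 0) :
    ∃ c : Y, ∀ᵐ t ∂volume.restrict (Ioo a b), w t = c := by
  obtain ⟨η, hη, hη1⟩ := exists_isTestFunctionOn_integral_eq_one hab
  set c : Y := ∫ t in Ioo a b, η t • w t
  have hconst : IntegrableOn (fun _ => c) (Ioo a b) := integrable_const c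
  refine ⟨c, ?_⟩
  have hae := (isOpen_Ioo (a := a) (b := b)).ae_eq_zero_of_integral_contDiff_smul_eq_zero
    (μ := volume.restrict (Ioo a b)) (f := fun t => w t - c)
    ((hw.sub hconst).locallyIntegrable.locallyIntegrableOn _) fun ψ hψ hψc hψs => ?_
  · filter_upwards [hae, ae_restrict_mem measurableSet_Ioo] with t h ht
    exact sub_eq_zero.1 (h ht)
  replace hψ : IsTestFunctionOn a b ψ := ⟨hψ, hψc, hψs⟩
  set m : ℝ := ∫ t, ψ t
  have hmean : ∫ t, (ψ t - m * η t) = 0 := by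
    rw [integral_sub (hψ.contDiff.continuous.integrable_of_hasCompactSupport hψc)
      ((hη.contDiff.continuous.integrable_of_hasCompactSupport hη.hasCompactSupport).const_mul m),
      integral_const_mul, hη1, mul_one, sub_self]
  obtain ⟨φ, hφ, hφd⟩ := (hψ.sub_const_mul hη m).exists_deriv_eq hmean
  have hzero : ∫ t in Ioo a b, (ψ t • w t - m • η t • w t) = 0 := by
    simpa [hφd, sub_smul, mul_smul] using hw' φ hφ
  rw [integral_sub (hψ.integrable_smul hw) (Integrable.fun_smul m (hη.integrable_smul hw)),
    integral_smul, sub_eq_zero] at hzero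
  simp only [smul_sub]
  rw [integral_sub (hψ.integrable_smul hw) (hψ.integrable_smul hconst), hzero,
    integral_smul_const, hψ.setIntegral_eq_integral, sub_self]

lemma IsTestFunctionOn.setIntegral_Ico_deriv {φ : ℝ → ℝ} (hφ : IsTestFunctionOn a b φ) {x : ℝ}
    (hx : x ≤ b) : ∫ t in Ico x b, _root_.deriv φ t = -φ x := by
  have hφb : φ b = 0 := hφ.eq_zero_of_notMem fun h => h.2.false
  rw [integral_Ico_eq_integral_Ioo, ← integral_Ioc_eq_integral_Ioo,
    ← intervalIntegral.integral_of_le hx, intervalIntegral.integral_deriv_eq_sub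
      (fun t _ => (hφ.contDiff.differentiable (by simp)).differentiableAt)
      (hφ.deriv.contDiff.continuous.intervalIntegrable _ _), hφb, zero_sub]

lemma hasWeakDerivOn_integral [CompleteSpace Y] {g : ℝ → Y} (hg : IntegrableOn g (Ioo a b)) :
    HasWeakDerivOn a b (fun t => ∫ x in a..t, g x) g := by
  intro φ hφ
  -- Fubini on the triangle `a < x ≤ t < b`.
  let F : ℝ × ℝ → Y := {q : ℝ × ℝ | q.2 ≤ q.1}.indicator fun q => deriv φ q.1 • g q.2
  have hφ' : IntegrableOn (deriv φ) (Ioo a b) :=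
    (hφ.deriv.contDiff.continuous.integrable_of_hasCompactSupport
      hφ.deriv.hasCompactSupport).integrableOn
  have hF : Integrable F ((volume.restrict (Ioo a b)).prod (volume.restrict (Ioo a b))) :=
    (hφ'.smul_prod hg).indicator (measurableSet_le measurable_snd measurable_fst)
  have hleft : ∀ t ∈ Ioo a b, deriv φ t • ∫ x in a..t, g x = ∫ x in Ioo a b, F (t, x) := by
    intro t ht
    have hset : Ioo a b ∩ Iic t = Ioc a t := by
      ext x
      exact ⟨fun h => ⟨h.1.1, h.2⟩, fun h => ⟨⟨h.1, h.2.trans_lt ht.2⟩, h.2⟩⟩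
    have hslice : (fun x => F (t, x)) = (Iic t).indicator fun x => deriv φ t • g x := rfl
    rw [hslice, setIntegral_indicator measurableSet_Iic, hset, integral_smul,
      intervalIntegral.integral_of_le ht.1.le]
  have hright : ∀ x ∈ Ioo a b, ∫ t in Ioo a b, F (t, x) = -(φ x • g x) := by
    intro x hx
    have hset : Ioo a b ∩ Ici x = Ico x b := by
      ext t
      exact ⟨fun h => ⟨h.2, h.1.2⟩, fun h => ⟨⟨hx.1.trans_le h.1, h.2⟩, h.1⟩⟩
    have hslice : (fun t => F (t, x)) = (Ici x).indicator fun t => deriv φ t • g x := rfl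
    rw [hslice, setIntegral_indicator measurableSet_Ici, hset, integral_smul_const,
      hφ.setIntegral_Ico_deriv hx.2.le, neg_smul]
  rw [setIntegral_congr_fun measurableSet_Ioo hleft,
    integral_integral_swap (f := fun t x => F (t, x)) hF,
    setIntegral_congr_fun measurableSet_Ioo hright, integral_neg]

lemma HasWeakDerivOn.exists_ae_eq_add_integral [CompleteSpace Y] {v v' : ℝ → Y}
    (h : HasWeakDerivOn a b v v') (hab : a < b) (hv : IntegrableOn v (Ioo a b))
    (hv' : IntegrableOn v' (Ioo a b)) :
    ∃ c : Y, ∀ᵐ t ∂volume.restrict (Ioo a b), v t = c + ∫ x in a..t, v' x := by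
  have hprim : IntegrableOn (fun t => ∫ x in a..t, v' x) (Ioo a b) := by
    have hcont : ContinuousOn (fun t => ∫ x in a..t, v' x) (Icc a b) := by
      rw [← uIcc_of_le hab.le]
      refine intervalIntegral.continuousOn_primitive_interval ?_
      rwa [uIcc_of_le hab.le, integrableOn_Icc_iff_integrableOn_Ioo]
    exact hcont.integrableOn_Icc.mono_set Ioo_subset_Icc_self
  obtain ⟨c, hc⟩ := exists_ae_eq_const_of_hasWeakDerivOn_zero hab (hv.sub hprim) fun φ hφ => by
    simp only [Pi.sub_apply, smul_sub, Pi.zero_apply, smul_zero, integral_zero, neg_zero]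
    rw [integral_sub (hφ.deriv.integrable_smul hv) (hφ.deriv.integrable_smul hprim), h φ hφ,
      hasWeakDerivOn_integral hv' φ hφ, sub_self]
  exact ⟨c, hc.mono fun t ht => sub_eq_iff_eq_add.1 ht⟩

end WeakDeriv

section Ehrling

variable {B Y E : Type*} [NormedAddCommGroup B] [NormedSpace ℝ B]
  [NormedAddCommGroup Y] [NormedSpace ℝ Y] [AddCommGroup E] [Module ℝ E]
  {M : SeminormedCone B} {ιB : B →ₗ[ℝ] E} {ιY : Y →ₗ[ℝ] E}

namespace SeminormedCone

/-- Ehrling's inequality with constants `ε` and `C`, for differences of elements of the cone which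
belong to `Y`: `‖a - b‖_B ≤ ε ([a] + [b]) + C ‖a - b‖_Y`. -/
def EhrlingInequality (M : SeminormedCone B) (ιB : B →ₗ[ℝ] E) (ιY : Y →ₗ[ℝ] E) (ε C : ℝ≥0) :
    Prop :=
  ∀ a ∈ M.carrier, ∀ b ∈ M.carrier, ∀ y : Y, ιB (a - b) = ιY y →
    ‖a - b‖ₑ ≤ ε * (‖M.gauge a‖ₑ + ‖M.gauge b‖ₑ) + C * ‖y‖ₑ

lemma CompactlyEmbedded.isCompact_closure (hM : M.CompactlyEmbedded) (R : ℝ) :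
    IsCompact (closure {b | b ∈ M.carrier ∧ M.gauge b ≤ R}) := by
  refine IsSeqCompact.isCompact fun x hx => ?_
  choose b hb hxb using fun n : ℕ =>
    Metric.mem_closure_iff.1 (hx n) (1 / ((n : ℝ) + 1)) (by positivity)
  obtain ⟨φ, hφ, a, ha⟩ := hM b (fun n => (hb n).1) ⟨R, fun n => (hb n).2⟩
  refine ⟨a, mem_closure_of_tendsto ha (Eventually.of_forall fun n => hb _), φ, hφ, ?_⟩
  have hdist : Tendsto (fun n => dist (b (φ n)) (x (φ n))) atTop (𝓝 0) := by
    refine squeeze_zero (fun n => dist_nonneg) (fun n => ?_)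
      (tendsto_one_div_add_atTop_nhds_zero_nat.comp hφ.tendsto_atTop)
    rw [dist_comm]
    exact (hxb _).le
  exact (tendsto_iff_of_dist hdist).1 ha

lemma gauge_inv_smul_le_one {a : B} (ha : a ∈ M.carrier) {σ : ℝ} (hσ : 0 < σ)
    (h : M.gauge a ≤ σ) : M.gauge (σ⁻¹ • a) ≤ 1 := by
  rwa [M.gauge_smul a ha _ (inv_nonneg.2 hσ.le), inv_mul_le_iff₀ hσ, mul_one]

lemma CompactlyEmbedded.exists_norm_le_mul_gauge (hM : M.CompactlyEmbedded) :
    ∃ R : ℝ, 0 ≤ R ∧ ∀ a ∈ M.carrier, ‖a‖ ≤ R * M.gauge a := by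
  obtain ⟨R, hR, hbound⟩ := (hM.isCompact_closure 1).isBounded.exists_pos_norm_le
  refine ⟨R, hR.le, fun a ha => ?_⟩
  rcases (M.gauge_nonneg a ha).eq_or_lt' with h0 | hpos
  · rw [h0, mul_zero, (M.gauge_eq_zero_iff a ha).1 h0, norm_zero]
  · have h := hbound _ (subset_closure ⟨M.smul_mem a ha _ (inv_nonneg.2 hpos.le),
      gauge_inv_smul_le_one ha hpos le_rfl⟩)
    rwa [norm_smul, Real.norm_of_nonneg (inv_nonneg.2 hpos.le), inv_mul_le_iff₀ hpos,
      mul_comm] at h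

lemma CompactlyEmbedded.exists_norm_sub_le_of_norm_le (hM : M.CompactlyEmbedded)
    (hlim : LimitCompatible ιB ιY) {ε : ℝ} (hε : 0 < ε) :
    ∃ δ > 0, ∀ a ∈ M.carrier, ∀ b ∈ M.carrier, M.gauge a ≤ 1 → M.gauge b ≤ 1 →
      ∀ y : Y, ιB (a - b) = ιY y → ‖y‖ ≤ δ → ‖a - b‖ ≤ ε := by
  by_contra! hcon
  choose a ha b hb ha1 hb1 y hy hyle hlt using fun n : ℕ =>
    hcon (1 / ((n : ℝ) + 1)) (by positivity)
  obtain ⟨φ, hφ, a', ha'⟩ := hM a ha ⟨1, ha1⟩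
  obtain ⟨ψ, hψ, b', hb'⟩ := hM (b ∘ φ) (fun n => hb _) ⟨1, fun n => hb1 _⟩
  have hw : Tendsto (fun n => a (φ (ψ n)) - b (φ (ψ n))) atTop (𝓝 (a' - b')) :=
    (ha'.comp hψ.tendsto_atTop).sub hb'
  have hy0 : Tendsto (fun n => y (φ (ψ n))) atTop (𝓝 0) :=
    squeeze_zero_norm (fun n => hyle _)
      (tendsto_one_div_add_atTop_nhds_zero_nat.comp (hφ.comp hψ).tendsto_atTop)
  rw [hlim _ _ _ (fun n => hy _) hw hy0] at hw
  have := ge_of_tendsto' hw.norm fun n => (hlt (φ (ψ n))).le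
  rw [norm_zero] at this
  exact this.not_gt hε

lemma CompactlyEmbedded.exists_norm_sub_le (hM : M.CompactlyEmbedded)
    (hlim : LimitCompatible ιB ιY) {ε : ℝ} (hε : 0 < ε) :
    ∃ C : ℝ, 0 ≤ C ∧ ∀ a ∈ M.carrier, ∀ b ∈ M.carrier, ∀ y : Y, ιB (a - b) = ιY y →
      ‖a - b‖ ≤ ε * (M.gauge a + M.gauge b) + C * ‖y‖ := by
  obtain ⟨δ, hδ, hsmall⟩ := hM.exists_norm_sub_le_of_norm_le hlim hε
  obtain ⟨R, hR, hbound⟩ := hM.exists_norm_le_mul_gauge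
  refine ⟨R / δ, by positivity, fun a ha b hb y hy => ?_⟩
  have ha0 := M.gauge_nonneg a ha
  have hb0 := M.gauge_nonneg b hb
  set σ := M.gauge a + M.gauge b
  have hσR : ‖a - b‖ ≤ R * σ :=
    (norm_sub_le a b).trans ((add_le_add (hbound a ha) (hbound b hb)).trans_eq (mul_add ..).symm)
  have hσ0 : 0 ≤ σ := add_nonneg ha0 hb0
  rcases hσ0.eq_or_lt' with hσ | hσ
  · rw [hσ, mul_zero] at hσR
    exact hσR.trans (by positivity)
  rcases le_or_gt ‖y‖ (δ * σ) with hyσ | hyσ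
  · have hinv : 0 ≤ σ⁻¹ := inv_nonneg.2 hσ.le
    have hscaled := hsmall (σ⁻¹ • a) (M.smul_mem a ha _ hinv) (σ⁻¹ • b) (M.smul_mem b hb _ hinv)
      (gauge_inv_smul_le_one ha hσ (le_add_of_nonneg_right hb0))
      (gauge_inv_smul_le_one hb hσ (le_add_of_nonneg_left ha0))
      (σ⁻¹ • y) (by rw [← smul_sub, map_smul, map_smul, hy])
      (by rwa [norm_smul, Real.norm_of_nonneg hinv, inv_mul_le_iff₀ hσ, mul_comm])
    rw [← smul_sub, norm_smul, Real.norm_of_nonneg hinv, inv_mul_le_iff₀ hσ, mul_comm] at hscaled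
    exact hscaled.trans (le_add_of_nonneg_right (by positivity))
  · calc ‖a - b‖ ≤ R * σ := hσR
      _ ≤ R * (‖y‖ / δ) := by
        gcongr
        exact (le_div_iff₀' hδ).2 hyσ.le
      _ = R / δ * ‖y‖ := by ring
      _ ≤ _ := le_add_of_nonneg_left (by positivity)

lemma CompactlyEmbedded.exists_ehrlingInequality (hM : M.CompactlyEmbedded)
    (hlim : LimitCompatible ιB ιY) {ε : ℝ≥0} (hε : 0 < ε) :
    ∃ C : ℝ≥0, M.EhrlingInequality ιB ιY ε C := by
  obtain ⟨C, hC, h⟩ := hM.exists_norm_sub_le hlim (NNReal.coe_pos.2 hε)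
  lift C to ℝ≥0 using hC
  refine ⟨C, fun a ha b hb y hy => ?_⟩
  have hab := h a ha b hb y hy
  rw [← Real.norm_of_nonneg (M.gauge_nonneg a ha), ← Real.norm_of_nonneg (M.gauge_nonneg b hb)]
    at hab
  simp only [enorm_eq_nnnorm]
  exact_mod_cast hab

end SeminormedCone

end Ehrling

section TimeDerivative

variable {B Y E : Type*} [NormedAddCommGroup B] [NormedSpace ℝ B]
  [NormedAddCommGroup Y] [NormedSpace ℝ Y] [AddCommGroup E] [Module ℝ E]
  {M : SeminormedCone B} {ιB : B →ₗ[ℝ] E} {ιY : Y →ₗ[ℝ] E} {p r : ℝ≥0∞} {T : ℝ}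

/-- `u` takes values in the cone `M` on the set `G` of full measure, and its increments between
points of `G` are vectors of `Y` whose norms are bounded by integrals of the density `f`. -/
structure IsRegularOn (M : SeminormedCone B) (ιB : B →ₗ[ℝ] E) (ιY : Y →ₗ[ℝ] E) (T : ℝ)
    (u : ℝ → B) (f : ℝ → ℝ≥0∞) (G : Set ℝ) : Prop where
  ae_mem : ∀ᵐ t ∂timeMeasure T, t ∈ G
  mem_carrier : ∀ t ∈ G, u t ∈ M.carrier
  increment : ∀ s ∈ G, ∀ t ∈ G, ∃ y : Y,
    ιB (u t - u s) = ιY y ∧ ‖y‖ₑ ≤ ∫⁻ x in uIoc s t, f x ∂timeMeasure T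

lemma exists_isRegularOn_of_hasWeakTimeDeriv [CompleteSpace Y] (hT : 0 < T) (hp : 1 ≤ p)
    (hr : 1 ≤ r) {u : Lp B p (timeMeasure T)} (huM : M.MemLpCone u)
    {v : Lp Y p (timeMeasure T)} {v' : Lp Y r (timeMeasure T)} (huv : SameFunction ιB ιY u v)
    (hv : HasWeakTimeDeriv v v') :
    ∃ G : Set ℝ, IsRegularOn M ιB ιY T u (fun x => ‖v' x‖ₑ) G := by
  have hv' : IntegrableOn v' (Ioo 0 T) := (Lp.memLp v').integrable hr
  obtain ⟨c, hc⟩ := HasWeakDerivOn.exists_ae_eq_add_integral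
    (fun φ hφ => hv φ hφ.contDiff hφ.hasCompactSupport hφ.tsupport_subset) hT
    ((Lp.memLp v).integrable hp) hv'
  refine ⟨{t | t ∈ Ioo 0 T ∧ u t ∈ M.carrier ∧ ιB (u t) = ιY (v t) ∧
    v t = c + ∫ x in (0)..t, v' x}, ?_, fun t ht => ht.2.1, ?_⟩
  · filter_upwards [ae_restrict_mem measurableSet_Ioo, huM.1, huv, hc] with t ht htM hut hvt
    exact ⟨ht, htM, hut, hvt⟩
  rintro s ⟨hs, -, hus, hvs⟩ t ⟨ht, -, hut, hvt⟩
  have hprim : ∀ t ∈ Ioo 0 T, IntervalIntegrable v' volume 0 t := fun t ht =>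
    (intervalIntegrable_iff_integrableOn_Ioc_of_le ht.1.le).2
      (hv'.mono_set (Ioc_subset_Ioo_right ht.2))
  refine ⟨∫ x in s..t, v' x, ?_, ?_⟩
  · rw [map_sub, hut, hus, ← map_sub, hvt, hvs, add_sub_add_left_eq_sub,
      intervalIntegral.integral_interval_sub_left (hprim t ht) (hprim s hs)]
  · have hsub : uIoc s t ⊆ Ioo 0 T :=
      uIoc_subset_uIcc.trans (ordConnected_Ioo.uIcc_subset hs ht)
    rw [Measure.restrict_restrict measurableSet_uIoc, inter_eq_left.2 hsub,
      ← enorm_norm, intervalIntegral.norm_intervalIntegral_eq, enorm_norm]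
    exact enorm_integral_le_lintegral_enorm _

lemma IsRegularOn.enorm_sub_le {u : ℝ → B} {f : ℝ → ℝ≥0∞} {G : Set ℝ}
    (h : IsRegularOn M ιB ιY T u f G) {ε C : ℝ≥0} (hE : M.EhrlingInequality ιB ιY ε C)
    {s t : ℝ} (hs : s ∈ G) (ht : t ∈ G) :
    ‖u t - u s‖ₑ ≤ ε * (‖M.gauge (u t)‖ₑ + ‖M.gauge (u s)‖ₑ) +
      C * ∫⁻ x in uIoc s t, f x ∂timeMeasure T := by
  obtain ⟨y, hy, hle⟩ := h.increment s hs t ht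
  refine (hE _ (h.mem_carrier t ht) _ (h.mem_carrier s hs) y hy).trans ?_
  gcongr

end TimeDerivative

section StepApproximation

variable {α : Type*} [MeasurableSpace α] {μ : Measure α} {p : ℝ≥0∞}

lemma exists_eLpNorm_const_le [IsFiniteMeasure μ] (hμ : μ ≠ 0) {g : α → ℝ≥0∞}
    (hg : AEMeasurable g μ) {G : Set α} (hG : ∀ᵐ t ∂μ, t ∈ G) :
    ∃ s ∈ G, eLpNorm (fun _ => g s) p μ ≤ eLpNorm g p μ := by
  have hne : (ae μ).NeBot := ae_neBot.2 hμ
  rcases eq_or_ne p 0 with rfl | hp0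
  · obtain ⟨s, hs⟩ := hG.exists
    exact ⟨s, hs, by simp⟩
  rcases eq_or_ne p ⊤ with rfl | hp
  · obtain ⟨s, hs, hle⟩ := (hG.and (ae_le_eLpNormEssSup (f := g))).exists
    refine ⟨s, hs, ?_⟩
    simpa only [eLpNorm_exponent_top, eLpNormEssSup_const _ hμ] using hle
  · obtain ⟨s, hs, hle⟩ := exists_notMem_null_le_laverage hμ (hg.pow_const p.toReal) hG
    refine ⟨s, not_not.1 hs, ?_⟩
    simp only [eLpNorm_eq_lintegral_rpow_enorm_toReal hp0 hp, enorm_eq_self, lintegral_const]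
    gcongr
    rwa [laverage_eq, ENNReal.le_div_iff_mul_le (Or.inl (Measure.measure_univ_ne_zero.2 hμ))
      (Or.inl (measure_ne_top _ _))] at hle

variable {ι : Type*} [Countable ι] [MeasurableSpace ι] [MeasurableSingletonClass ι] {κ : α → ι}

lemma lintegral_eq_tsum_setLIntegral_fiber (hκ : Measurable κ) (F : α → ℝ≥0∞) :
    ∫⁻ t, F t ∂μ = ∑' k, ∫⁻ t in κ ⁻¹' {k}, F t ∂μ := by
  rw [← lintegral_iUnion (fun k => hκ (measurableSet_singleton k))
    (fun i j hij => Disjoint.preimage κ (disjoint_singleton.2 hij)),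
    ← preimage_iUnion, iUnion_of_singleton, preimage_univ, Measure.restrict_univ]

lemma lintegral_setLIntegral_fiber {h : ℝ≥0∞} (hκ : Measurable κ)
    (hμ : ∀ k, μ (κ ⁻¹' {k}) = h) (F : α → ℝ≥0∞) :
    ∫⁻ t, ∫⁻ x in κ ⁻¹' {κ t}, F x ∂μ ∂μ = h * ∫⁻ x, F x ∂μ := by
  have hcell : ∀ k, ∫⁻ t in κ ⁻¹' {k}, ∫⁻ x in κ ⁻¹' {κ t}, F x ∂μ ∂μ =
      h * ∫⁻ x in κ ⁻¹' {k}, F x ∂μ := fun k => by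
    rw [setLIntegral_congr_fun (g := fun _ => ∫⁻ x in κ ⁻¹' {k}, F x ∂μ)
      (hκ (measurableSet_singleton k)) fun t ht => by rw [show κ t = k from ht],
      setLIntegral_const, hμ, mul_comm]
  rw [lintegral_eq_tsum_setLIntegral_fiber hκ, lintegral_eq_tsum_setLIntegral_fiber hκ F,
    ← ENNReal.tsum_mul_left]
  exact tsum_congr hcell

lemma eLpNorm_le_of_forall_fiber {f g : α → ℝ≥0∞} (hκ : Measurable κ)
    (h : ∀ k, eLpNorm f p (μ.restrict (κ ⁻¹' {k})) ≤ eLpNorm g p (μ.restrict (κ ⁻¹' {k}))) :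
    eLpNorm f p μ ≤ eLpNorm g p μ := by
  rcases eq_or_ne p 0 with rfl | hp0
  · simp
  rcases eq_or_ne p ⊤ with rfl | hp
  · simp only [eLpNorm_exponent_top] at h ⊢
    refine essSup_le_of_ae_le _ ?_
    have hcells : ∀ᵐ t ∂μ.restrict (⋃ k, κ ⁻¹' {k}), ‖f t‖ₑ ≤ eLpNormEssSup g μ :=
      (ae_restrict_iUnion_iff _ _).2 fun k => (ae_le_eLpNormEssSup (f := f)).mono fun t ht =>
        ht.trans ((h k).trans
          (eLpNormEssSup_mono_measure _ Measure.restrict_le_self.absolutelyContinuous))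
    rwa [← preimage_iUnion, iUnion_of_singleton, preimage_univ, Measure.restrict_univ] at hcells
  · simp only [eLpNorm_eq_lintegral_rpow_enorm_toReal hp0 hp] at h ⊢
    have hq : 0 < 1 / p.toReal := one_div_pos.2 (ENNReal.toReal_pos hp0 hp)
    refine ENNReal.rpow_le_rpow ?_ hq.le
    rw [lintegral_eq_tsum_setLIntegral_fiber hκ,
      lintegral_eq_tsum_setLIntegral_fiber hκ fun t => ‖g t‖ₑ ^ p.toReal]
    exact ENNReal.tsum_le_tsum fun k => (ENNReal.rpow_le_rpow_iff hq).1 (h k)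

lemma exists_eLpNorm_sub_step_le {B : Type*} [NormedAddCommGroup B] [IsFiniteMeasure μ]
    (hκ : Measurable κ) (hμ : ∀ k, μ (κ ⁻¹' {k}) ≠ 0) (hp : 1 ≤ p) {u : α → B} {g : α → ℝ≥0∞}
    (hg : AEMeasurable g μ) {G : Set α} (hG : ∀ᵐ t ∂μ, t ∈ G) {A : ι → ℝ≥0∞} {ε : ℝ≥0∞}
    (hle : ∀ s ∈ G, ∀ t ∈ G, κ s = κ t → ‖u t - u s‖ₑ ≤ ε * (g t + g s) + A (κ t)) :
    ∃ s : ι → α, (∀ k, s k ∈ G) ∧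
      (∀ k, g (s k) * μ (κ ⁻¹' {k}) ^ (1 / p.toReal) ≤ eLpNorm g p μ) ∧
      eLpNorm (fun t => u t - u (s (κ t))) p μ ≤
        ε * (eLpNorm g p μ + eLpNorm g p μ) + eLpNorm (fun t => A (κ t)) p μ := by
  have hcell : ∀ k, μ.restrict (κ ⁻¹' {k}) ≠ 0 := fun k => by
    simpa [Measure.restrict_eq_zero] using hμ k
  have hcellG : ∀ k, ∀ᵐ t ∂μ.restrict (κ ⁻¹' {k}), t ∈ G ∩ κ ⁻¹' {k} := fun k =>
    (ae_restrict_of_ae hG).and (ae_restrict_mem (hκ (measurableSet_singleton k)))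
  choose s hs hgs using fun k => exists_eLpNorm_const_le (p := p) (hcell k) hg.restrict (hcellG k)
  have hstep : ∀ F : ι → ℝ≥0∞, AEStronglyMeasurable (fun t => F (κ t)) μ := fun F =>
    ((measurable_of_countable F).comp hκ).aestronglyMeasurable
  have hgstep : eLpNorm (fun t => g (s (κ t))) p μ ≤ eLpNorm g p μ :=
    eLpNorm_le_of_forall_fiber hκ fun k => (eLpNorm_congr_ae <|
      (ae_restrict_mem (hκ (measurableSet_singleton k))).mono fun t ht => by
        simp only [show κ t = k from ht]).trans_le (hgs k)
  refine ⟨s, fun k => (hs k).1, fun k => ?_, ?_⟩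
  · have hconst := hgs k
    rw [eLpNorm_const _ (zero_lt_one.trans_le hp).ne' (hcell k), enorm_eq_self,
      Measure.restrict_apply_univ] at hconst
    exact hconst.trans (eLpNorm_mono_measure _ Measure.restrict_le_self)
  · calc eLpNorm (fun t => u t - u (s (κ t))) p μ
        ≤ eLpNorm ((fun t => ε * (g t + g (s (κ t)))) + fun t => A (κ t)) p μ := by
          refine eLpNorm_mono_enorm_ae (hG.mono fun t ht => ?_)
          exact hle _ (hs (κ t)).1 t ht (hs (κ t)).2
      _ ≤ eLpNorm (fun t => ε * (g t + g (s (κ t)))) p μ + eLpNorm (fun t => A (κ t)) p μ :=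
          eLpNorm_add_le ((hg.add (hstep fun k => g (s k)).aemeasurable).const_mul
            ε).aestronglyMeasurable (hstep A) hp
      _ ≤ ε * eLpNorm (g + fun t => g (s (κ t))) p μ + eLpNorm (fun t => A (κ t)) p μ := by
          gcongr
          exact eLpNorm_le_mul_eLpNorm_of_ae_le_mul'' p
            (hg.aestronglyMeasurable.add (hstep fun k => g (s k)))
            (Eventually.of_forall fun t => le_rfl)
      _ ≤ ε * (eLpNorm g p μ + eLpNorm g p μ) + eLpNorm (fun t => A (κ t)) p μ := by
          gcongr
          exact (eLpNorm_add_le hg.aestronglyMeasurable (hstep fun k => g (s k)) hp).trans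
            (add_le_add_right hgstep _)

lemma eLpNorm_setLIntegral_fiber_le {h : ℝ≥0∞} (hκ : Measurable κ)
    (hμ : ∀ k, μ (κ ⁻¹' {k}) = h) (hp : 1 ≤ p) (hp' : p ≠ ⊤) (f : α → ℝ≥0∞) :
    eLpNorm (fun t => ∫⁻ x in κ ⁻¹' {κ t}, f x ∂μ) p μ ≤ (∫⁻ x, f x ∂μ) * h ^ (1 / p.toReal) := by
  have hp0 : p ≠ 0 := (zero_lt_one.trans_le hp).ne'
  have hq0 : 0 < p.toReal := ENNReal.toReal_pos hp0 hp'
  have hq1 : 0 ≤ p.toReal - 1 := sub_nonneg.2 (by simpa using ENNReal.toReal_mono hp' hp)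
  set a := ∫⁻ x, f x ∂μ
  have hsplit : ∀ x : ℝ≥0∞, x ^ p.toReal = x ^ (p.toReal - 1) * x := fun x => by
    simpa using ENNReal.rpow_add_of_nonneg (x := x) _ _ hq1 zero_le_one
  rw [eLpNorm_eq_lintegral_rpow_enorm_toReal hp0 hp']
  simp only [enorm_eq_self]
  calc (∫⁻ t, (∫⁻ x in κ ⁻¹' {κ t}, f x ∂μ) ^ p.toReal ∂μ) ^ (1 / p.toReal)
      ≤ (a ^ (p.toReal - 1) * (h * a)) ^ (1 / p.toReal) := by
        refine ENNReal.rpow_le_rpow ?_ (by positivity)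
        rw [← lintegral_setLIntegral_fiber hκ hμ f, ← lintegral_const_mul]
        · refine lintegral_mono fun t => ?_
          rw [hsplit]
          gcongr
          exact setLIntegral_le_lintegral _ _
        · exact (measurable_of_countable fun k => ∫⁻ x in κ ⁻¹' {k}, f x ∂μ).comp hκ
    _ = (a ^ p.toReal * h) ^ (1 / p.toReal) := by rw [hsplit a]; ring_nf
    _ = a * h ^ (1 / p.toReal) := by
        rw [ENNReal.mul_rpow_of_nonneg _ _ (by positivity), ← ENNReal.rpow_mul,
          mul_one_div_cancel hq0.ne', ENNReal.rpow_one]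

lemma lintegral_le_eLpNorm_mul_rpow_measure_univ {r : ℝ≥0∞} (hr : 1 ≤ r) {f : α → ℝ≥0∞}
    (hf : AEMeasurable f μ) :
    ∫⁻ x, f x ∂μ ≤ eLpNorm f r μ * μ univ ^ (1 - 1 / r.toReal) := by
  simpa [eLpNorm_one_eq_lintegral_enorm] using
    eLpNorm_le_eLpNorm_mul_rpow_measure_univ hr hf.aestronglyMeasurable

end StepApproximation

section Equipartition

lemma exists_eLpNorm_setLIntegral_fiber_le {α : Type*} [MeasurableSpace α] {μ : Measure α}
    [IsFiniteMeasure μ] {p r : ℝ≥0∞} (hp : 1 ≤ p) (hr : 1 ≤ r) (hpr : p = ⊤ → 1 < r) :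
    ∃ K : ℝ≥0∞, K ≠ ⊤ ∧ ∃ θ : ℝ, 0 < θ ∧ ∀ {n : ℕ} {κ : α → Fin n} {h : ℝ≥0∞}, Measurable κ →
      (∀ k, μ (κ ⁻¹' {k}) = h) → ∀ {f : α → ℝ≥0∞}, AEMeasurable f μ →
        eLpNorm (fun t => ∫⁻ x in κ ⁻¹' {κ t}, f x ∂μ) p μ ≤ K * eLpNorm f r μ * h ^ θ := by
  have hr' : 0 ≤ 1 - 1 / r.toReal := by
    rw [sub_nonneg, one_div, ← ENNReal.toReal_inv]
    simpa using ENNReal.toReal_mono ENNReal.one_ne_top (ENNReal.inv_le_one.2 hr)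
  rcases eq_or_ne p ⊤ with rfl | hp'
  · refine ⟨1, ENNReal.one_ne_top, 1 - 1 / r.toReal, ?_, fun {n κ h} _ hμ f hf => ?_⟩
    · rw [sub_pos, one_div, ← ENNReal.toReal_inv]
      simpa using ENNReal.toReal_strict_mono ENNReal.one_ne_top (ENNReal.inv_lt_one.2 (hpr rfl))
    · rw [eLpNorm_exponent_top, one_mul]
      refine essSup_le_of_ae_le _ (Eventually.of_forall fun t => ?_)
      have hcell := lintegral_le_eLpNorm_mul_rpow_measure_univ hr (hf.restrict (s := κ ⁻¹' {κ t}))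
      rw [Measure.restrict_apply_univ, hμ] at hcell
      simp only [enorm_eq_self]
      refine hcell.trans ?_
      gcongr
      exact Measure.restrict_le_self
  · refine ⟨μ univ ^ (1 - 1 / r.toReal), ENNReal.rpow_ne_top_of_nonneg hr' (measure_ne_top _ _),
      1 / p.toReal, one_div_pos.2 (ENNReal.toReal_pos (zero_lt_one.trans_le hp).ne' hp'),
      fun hκ hμ f hf => ?_⟩
    refine (eLpNorm_setLIntegral_fiber_le hκ hμ hp hp' f).trans ?_
    rw [mul_comm (_ ^ _) (eLpNorm f r μ)]
    gcongr
    exact lintegral_le_eLpNorm_mul_rpow_measure_univ hr hf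

lemma exists_monotone_measure_fiber_eq {T : ℝ} (hT : 0 < T) (n : ℕ) :
    ∃ κ : ℝ → Fin (n + 1), Monotone κ ∧
      ∀ k, timeMeasure T (κ ⁻¹' {k}) = ENNReal.ofReal (T / ((n : ℝ) + 1)) := by
  set h : ℝ := T / (n + 1) with hh
  have hpos : 0 < h := by positivity
  have hTh : T = (n + 1) * h := by rw [hh]; field_simp
  let κ : ℝ → Fin (n + 1) := fun t => ⟨min ⌊t / h⌋₊ n, by omega⟩
  have hmono : Monotone κ := fun s t hst => by
    simp only [κ, Fin.mk_le_mk]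
    gcongr
  refine ⟨κ, hmono, fun k => ?_⟩
  have hfloor : ∀ t, 0 ≤ t → (⌊t / h⌋₊ = k ↔ t ∈ Ico (k * h) ((k + 1) * h)) := fun t ht => by
    rw [Nat.floor_eq_iff (by positivity), le_div_iff₀ hpos, div_lt_iff₀ hpos, mem_Ico]
  have hfiber : κ ⁻¹' {k} ∩ Ico 0 T = Ico (k * h) ((k + 1) * h) := by
    ext t
    constructor
    · rintro ⟨htk, ht0, htT⟩
      have hlt : ⌊t / h⌋₊ < n + 1 := by
        rw [Nat.floor_lt (by positivity), div_lt_iff₀ hpos]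
        push_cast
        rwa [← hTh]
      have hmin : min ⌊t / h⌋₊ n = k := congrArg Fin.val (show κ t = k from htk)
      exact (hfloor t ht0).1 (by omega)
    · intro ht
      have ht0 : 0 ≤ t := le_trans (by positivity) ht.1
      have hkn : (k : ℝ) + 1 ≤ n + 1 := by exact_mod_cast k.2
      refine ⟨Fin.ext (?_ : min ⌊t / h⌋₊ n = k), ht0, ht.2.trans_le ?_⟩
      · have := (hfloor t ht0).2 ht
        omega
      · rw [hTh]
        gcongr
  rw [timeMeasure, Measure.restrict_congr_set Ioo_ae_eq_Ico,
    Measure.restrict_apply (hmono.measurable (measurableSet_singleton k)), hfiber, Real.volume_Ico]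
  ring_nf

lemma tendsto_mul_ofReal_div_rpow {K : ℝ≥0∞} (hK : K ≠ ⊤) {θ : ℝ} (hθ : 0 < θ) (T : ℝ) :
    Tendsto (fun n : ℕ => K * ENNReal.ofReal (T / ((n : ℝ) + 1)) ^ θ) atTop (𝓝 0) := by
  have hdiv : Tendsto (fun n : ℕ => T / ((n : ℝ) + 1)) atTop (𝓝 0) :=
    tendsto_const_nhds.div_atTop
      (tendsto_atTop_add_const_right _ _ tendsto_natCast_atTop_atTop)
  have hrpow := (ENNReal.tendsto_ofReal hdiv).ennrpow_const θ
  rw [ENNReal.ofReal_zero, ENNReal.zero_rpow_of_pos hθ] at hrpow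
  simpa using ENNReal.Tendsto.const_mul hrpow (Or.inr hK)

end Equipartition

section Compactness

variable {B Y E : Type*} [NormedAddCommGroup B] [NormedSpace ℝ B]
  [NormedAddCommGroup Y] [NormedSpace ℝ Y] [AddCommGroup E] [Module ℝ E]
  {M : SeminormedCone B} {ιB : B →ₗ[ℝ] E} {ιY : Y →ₗ[ℝ] E} {p r : ℝ≥0∞} {T : ℝ}

lemma IsRegularOn.exists_step_approx {u : ℝ → B} {f : ℝ → ℝ≥0∞} {G : Set ℝ}
    (hu : IsRegularOn M ιB ιY T u f G) {ε C : ℝ≥0} (hE : M.EhrlingInequality ιB ιY ε C)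
    (hp : 1 ≤ p) (hg : AEMeasurable (fun t => ‖M.gauge (u t)‖ₑ) (timeMeasure T))
    {n : ℕ} {κ : ℝ → Fin n} (hκ : Monotone κ) (hκ0 : ∀ k, timeMeasure T (κ ⁻¹' {k}) ≠ 0) :
    ∃ x : Fin n → B, (∀ k, x k ∈ M.carrier) ∧
      (∀ k, ‖M.gauge (x k)‖ₑ * timeMeasure T (κ ⁻¹' {k}) ^ (1 / p.toReal) ≤
        eLpNorm (fun t => M.gauge (u t)) p (timeMeasure T)) ∧
      eLpNorm (fun t => u t - x (κ t)) p (timeMeasure T) ≤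
        ε * (eLpNorm (fun t => M.gauge (u t)) p (timeMeasure T) +
          eLpNorm (fun t => M.gauge (u t)) p (timeMeasure T)) +
        C * eLpNorm (fun t => ∫⁻ x in κ ⁻¹' {κ t}, f x ∂timeMeasure T) p (timeMeasure T) := by
  have hosc : ∀ s ∈ G, ∀ t ∈ G, κ s = κ t → ‖u t - u s‖ₑ ≤
      ε * (‖M.gauge (u t)‖ₑ + ‖M.gauge (u s)‖ₑ) +
        C * ∫⁻ x in κ ⁻¹' {κ t}, f x ∂timeMeasure T := fun s hs t ht hst => by
    have hsub : uIoc s t ⊆ κ ⁻¹' {κ t} :=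
      uIoc_subset_uIcc.trans ((ordConnected_singleton.preimage_mono hκ).uIcc_subset hst rfl)
    refine (hu.enorm_sub_le hE hs ht).trans ?_
    gcongr
  obtain ⟨s, hsG, hsg, hs⟩ := exists_eLpNorm_sub_step_le hκ.measurable hκ0 hp hg hu.ae_mem
    (A := fun k => C * ∫⁻ x in κ ⁻¹' {k}, f x ∂timeMeasure T) hosc
  rw [eLpNorm_enorm] at hs
  refine ⟨u ∘ s, fun k => hu.mem_carrier _ (hsG k), fun k => (hsg k).trans_eq (eLpNorm_enorm _),
    hs.trans ?_⟩
  gcongr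
  exact eLpNorm_le_mul_eLpNorm_of_ae_le_mul'' p
    ((measurable_of_countable fun k => ∫⁻ x in κ ⁻¹' {k}, f x ∂timeMeasure T).comp
      hκ.measurable).aestronglyMeasurable (Eventually.of_forall fun t => le_rfl)

lemma BoundedTimeDeriv.exists_isRegularOn [CompleteSpace Y] (hT : 0 < T) (hp : 1 ≤ p) (hr : 1 ≤ r)
    {U : Set (Lp B p (timeMeasure T))} (hUM : ∀ u ∈ U, M.MemLpCone u)
    (hderiv : BoundedTimeDeriv ιB ιY U r) :
    ∃ C : ℝ≥0, ∀ u ∈ U, ∃ (f : ℝ → ℝ≥0∞) (G : Set ℝ), AEMeasurable f (timeMeasure T) ∧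
      eLpNorm f r (timeMeasure T) ≤ C ∧ IsRegularOn M ιB ιY T u f G := by
  obtain ⟨C, hC⟩ := hderiv
  refine ⟨C.toNNReal, fun u hu => ?_⟩
  obtain ⟨v, huv, v', hv, hv'⟩ := hC u hu
  obtain ⟨G, hG⟩ := exists_isRegularOn_of_hasWeakTimeDeriv hT hp hr (hUM u hu) huv hv
  refine ⟨_, G, (Lp.aestronglyMeasurable v').enorm, ?_, hG⟩
  rw [eLpNorm_enorm, ← Lp.enorm_def]
  exact enorm_le_coe.2 (NNReal.le_toNNReal_of_coe_le hv')

lemma exists_eLpNorm_sub_step_le_of_bounded [CompleteSpace Y] (hT : 0 < T) (hp : 1 ≤ p)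
    (hr : 1 ≤ r) (hpr : p = ⊤ → 1 < r) (hcompact : M.CompactlyEmbedded)
    (hlimit : LimitCompatible ιB ιY) {U : Set (Lp B p (timeMeasure T))}
    (hUM : M.BoundedInLpCone U) (hderiv : BoundedTimeDeriv ιB ιY U r) {δ : ℝ≥0∞} (hδ : δ ≠ 0) :
    ∃ (n : ℕ) (κ : ℝ → Fin n) (R : ℝ), Measurable κ ∧ ∀ u ∈ U, ∃ x : Fin n → B,
      (∀ k, x k ∈ M.carrier ∧ M.gauge (x k) ≤ R) ∧
        eLpNorm (fun t => u t - x (κ t)) p (timeMeasure T) ≤ δ := by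
  obtain ⟨C₁, hC₁⟩ := hUM
  obtain ⟨C₂, hC₂⟩ := hderiv.exists_isRegularOn hT hp hr fun u hu => (hC₁ u hu).1
  have hδ2 : δ / 2 ≠ 0 := (ENNReal.half_pos hδ).ne'
  obtain ⟨ε, hε, hεδ⟩ := ENNReal.exists_nnreal_pos_mul_lt (a := C₁ + C₁) (by finiteness) hδ2
  obtain ⟨C, hE⟩ := hcompact.exists_ehrlingInequality hlimit hε
  obtain ⟨K, hK, θ, hθ, hfiber⟩ :=
    exists_eLpNorm_setLIntegral_fiber_le (μ := timeMeasure T) hp hr hpr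
  obtain ⟨n, hn⟩ := ((tendsto_mul_ofReal_div_rpow (K := C * (K * C₂)) (by finiteness) hθ
    T).eventually_le_const hδ2.bot_lt).exists
  obtain ⟨κ, hκ, hκh⟩ := exists_monotone_measure_fiber_eq hT n
  set h := ENNReal.ofReal (T / ((n : ℝ) + 1))
  have hh : h ≠ 0 := (ENNReal.ofReal_pos.2 (by positivity)).ne'
  have hhp : h ^ (1 / p.toReal) ≠ 0 := (ENNReal.rpow_pos hh.bot_lt ENNReal.ofReal_ne_top).ne'
  refine ⟨n + 1, κ, (C₁ / h ^ (1 / p.toReal)).toReal, hκ.measurable, fun u hu => ?_⟩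
  obtain ⟨⟨-, hγ⟩, hγC⟩ := hC₁ u hu
  obtain ⟨f, G, hf, hfC, hreg⟩ := hC₂ u hu
  obtain ⟨x, hxM, hxg, hx⟩ := hreg.exists_step_approx hE hp hγ.aestronglyMeasurable.enorm
    hκ fun k => by rwa [hκh]
  refine ⟨x, fun k => ⟨hxM k, ?_⟩, hx.trans ?_⟩
  · have hxk : ‖M.gauge (x k)‖ₑ ≤ C₁ / h ^ (1 / p.toReal) := by
      rw [ENNReal.le_div_iff_mul_le (Or.inl hhp) (Or.inr ENNReal.coe_ne_top), ← hκh k]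
      exact (hxg k).trans hγC
    rw [← Real.norm_of_nonneg (M.gauge_nonneg _ (hxM k)), ← toReal_enorm]
    exact ENNReal.toReal_mono (ENNReal.div_ne_top ENNReal.coe_ne_top hhp) hxk
  · calc _ ≤ ε * (C₁ + C₁) + C * (K * C₂ * h ^ θ) := by
          gcongr
          refine (hfiber hκ.measurable hκh hf).trans ?_
          gcongr
      _ ≤ δ / 2 + δ / 2 := by
          gcongr
          rwa [← mul_assoc]
      _ = δ := ENNReal.add_halves δ

end Compactness

section StepFunctions

variable {α B X : Type*} [MeasurableSpace α] {μ : Measure α} [IsFiniteMeasure μ]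
  [NormedAddCommGroup B] [PseudoMetricSpace X] {p : ℝ≥0∞} [Fact (1 ≤ p)]

lemma exists_lipschitzWith_toLp_of_norm_sub_le_dist {F : X → α → B} (hF : ∀ x, MemLp (F x) p μ)
    (hd : ∀ x y t, ‖F x t - F y t‖ ≤ dist x y) :
    ∃ K, LipschitzWith K fun x => (hF x).toLp (F x) := by
  have htop : μ univ ^ p.toReal⁻¹ ≠ ⊤ :=
    ENNReal.rpow_ne_top_of_nonneg (by positivity) (measure_ne_top _ _)
  refine ⟨(μ univ ^ p.toReal⁻¹).toNNReal, fun x y => ?_⟩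
  rw [Lp.edist_toLp_toLp, ENNReal.coe_toNNReal htop, edist_dist]
  exact eLpNorm_le_of_ae_bound (Eventually.of_forall (hd x y))

lemma exists_isCompact_forall_step_mem {n : ℕ} {κ : α → Fin n} (hκ : Measurable κ) {Q : Set B}
    (hQ : IsCompact Q) :
    ∃ K : Set (Lp B p μ), IsCompact K ∧
      ∀ x : Fin n → B, (∀ k, x k ∈ Q) → ∃ w ∈ K, w =ᵐ[μ] fun t => x (κ t) := by
  have hmem : ∀ x : Fin n → B, MemLp (fun t => x (κ t)) p μ := fun x =>
    MemLp.of_bound ((StronglyMeasurable.of_discrete).comp_measurable hκ).aestronglyMeasurable ‖x‖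
      (Eventually.of_forall fun t => norm_le_pi_norm x _)
  obtain ⟨_, hlip⟩ := exists_lipschitzWith_toLp_of_norm_sub_le_dist hmem fun x y t => by
    rw [← dist_eq_norm]
    exact dist_le_pi_dist x y _
  exact ⟨_, (isCompact_univ_pi fun _ => hQ).image hlip.continuous, fun x hx =>
    ⟨_, mem_image_of_mem _ fun k _ => hx k, (hmem x).coeFn_toLp⟩⟩

end StepFunctions

lemma totallyBounded_of_forall_exists_isCompact {X : Type*} [PseudoEMetricSpace X] {U : Set X}
    (h : ∀ δ ≠ 0, ∃ K : Set X, IsCompact K ∧ ∀ u ∈ U, ∃ x ∈ K, edist u x ≤ δ) :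
    TotallyBounded U := by
  rw [EMetric.totallyBounded_iff]
  intro ε hε
  have hε2 := ENNReal.half_pos hε.ne'
  obtain ⟨δ, hδ, hδε⟩ := exists_between hε2
  obtain ⟨K, hK, hU⟩ := h δ hδ.ne'
  obtain ⟨t, ht, hcov⟩ := EMetric.totallyBounded_iff.1 hK.totallyBounded (ε / 2) hε2
  refine ⟨t, ht, fun u hu => ?_⟩
  obtain ⟨x, hx, hux⟩ := hU u hu
  obtain ⟨y, hy, hxy⟩ := mem_iUnion₂.1 (hcov hx)
  refine mem_iUnion₂.2 ⟨y, hy, ?_⟩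
  calc edist u y ≤ edist u x + edist x y := edist_triangle _ _ _
    _ < ε / 2 + ε / 2 := ENNReal.add_lt_add (hux.trans_lt hδε) hxy
    _ = ε := ENNReal.add_halves ε

theorem isCompact_closure_of_boundedTimeDeriv {B Y E : Type*} [NormedAddCommGroup B]
    [NormedSpace ℝ B] [CompleteSpace B] [NormedAddCommGroup Y] [NormedSpace ℝ Y] [CompleteSpace Y]
    [AddCommGroup E] [Module ℝ E] {M : SeminormedCone B} {ιB : B →ₗ[ℝ] E} {ιY : Y →ₗ[ℝ] E}
    {p r : ℝ≥0∞} [Fact (1 ≤ p)] {T : ℝ} (hT : 0 < T) (hr : 1 ≤ r) (hpr : p = ⊤ → 1 < r)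
    (hcompact : M.CompactlyEmbedded) (hlimit : LimitCompatible ιB ιY)
    {U : Set (Lp B p (timeMeasure T))} (hUM : M.BoundedInLpCone U)
    (hderiv : BoundedTimeDeriv ιB ιY U r) : IsCompact (closure U) := by
  refine (totallyBounded_of_forall_exists_isCompact fun δ hδ => ?_).closure.isCompact_of_isClosed
    isClosed_closure
  obtain ⟨n, κ, R, hκ, hU⟩ := exists_eLpNorm_sub_step_le_of_bounded hT Fact.out hr hpr hcompact
    hlimit hUM hderiv hδ
  obtain ⟨K, hK, hstep⟩ := exists_isCompact_forall_step_mem (p := p) (μ := timeMeasure T) hκ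
    (hcompact.isCompact_closure R)
  refine ⟨K, hK, fun u hu => ?_⟩
  obtain ⟨x, hx, hle⟩ := hU u hu
  obtain ⟨w, hw, hwx⟩ := hstep x fun k => subset_closure (hx k)
  refine ⟨w, hw, ?_⟩
  rw [Lp.edist_def]
  exact (eLpNorm_congr_ae ((ae_eq_refl _).sub hwx)).trans_le hle

section ContinuousRepresentatives

variable {B : Type*} [NormedAddCommGroup B] {T : ℝ}

lemma dense_of_ae_timeMeasure (hT : 0 < T) {G : Set ℝ} (hG : ∀ᵐ t ∂timeMeasure T, t ∈ G) :
    Dense {x : Icc (0 : ℝ) T | (x : ℝ) ∈ G} := by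
  have hdense : Dense {t : ℝ | t ∈ Ioo 0 T → t ∈ G} :=
    Measure.dense_of_ae ((ae_restrict_iff' measurableSet_Ioo).1 hG)
  rw [Subtype.dense_iff, ← closure_Ioo hT.ne]
  refine closure_minimal ((hdense.open_subset_closure_inter isOpen_Ioo).trans
    (closure_mono ?_)) isClosed_closure
  rintro t ⟨ht, htG⟩
  rw [closure_Ioo hT.ne]
  exact ⟨⟨t, Ioo_subset_Icc_self ht⟩, htG ht, rfl⟩

lemma exists_continuousMap_of_uniformContinuousOn {X Z : Type*} [UniformSpace X] [UniformSpace Z]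
    [CompleteSpace Z] [T0Space Z] {S : Set X} (hS : Dense S) {g : X → Z}
    (hg : UniformContinuousOn g S) : ∃ f : C(X, Z), ∀ x ∈ S, f x = g x := by
  have huc := uniformContinuousOn_iff_restrict.1 hg
  exact ⟨⟨hS.extend (S.domRestrict g), (hS.uniformContinuous_extend huc).continuous⟩,
    fun x hx => hS.extend_of_ind huc ⟨x, hx⟩⟩

lemma exists_isContinuousRep_of_uniformContinuousOn [CompleteSpace B] (hT : 0 < T) {p : ℝ≥0∞}
    {u : Lp B p (timeMeasure T)} {G : Set ℝ} (hG : ∀ᵐ t ∂timeMeasure T, t ∈ G)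
    (hu : UniformContinuousOn u G) : ∃ f : C(Icc (0 : ℝ) T, B), IsContinuousRep u f := by
  obtain ⟨f, hf⟩ := exists_continuousMap_of_uniformContinuousOn (dense_of_ae_timeMeasure hT hG)
    (hu.comp (uniformContinuous_subtype_val.uniformContinuousOn) fun _ hx => hx)
  exact ⟨f, hG.mono fun _ ht htI => hf ⟨_, htI⟩ ht⟩

lemma memLp_comp_projIcc (hT : 0 ≤ T) (p : ℝ≥0∞) (f : C(Icc (0 : ℝ) T, B)) :
    MemLp (fun t => f (projIcc 0 T hT t)) p (timeMeasure T) :=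
  MemLp.of_bound (f.continuous.comp continuous_projIcc).aestronglyMeasurable ‖f‖
    (Eventually.of_forall fun _ => f.norm_coe_le_norm _)

/-- The class in `L^p(0,T;B)` of a continuous function on `[0,T]`, which is first extended to `ℝ`
by constants. -/
noncomputable def continuousToLp (hT : 0 ≤ T) (p : ℝ≥0∞) (f : C(Icc (0 : ℝ) T, B)) :
    Lp B p (timeMeasure T) :=
  (memLp_comp_projIcc hT p f).toLp _

lemma isContinuousRep_continuousToLp (hT : 0 ≤ T) (p : ℝ≥0∞) (f : C(Icc (0 : ℝ) T, B)) :
    IsContinuousRep (continuousToLp hT p f) f := by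
  filter_upwards [(memLp_comp_projIcc hT p f).coeFn_toLp] with _ ht htI
  rw [continuousToLp, ht, projIcc_of_mem hT htI]

lemma isContinuousRep_iff_continuousToLp_eq (hT : 0 ≤ T) {p : ℝ≥0∞}
    {u : Lp B p (timeMeasure T)} {f : C(Icc (0 : ℝ) T, B)} :
    IsContinuousRep u f ↔ continuousToLp hT p f = u := by
  refine ⟨fun hf => Lp.ext ?_, fun hu => hu ▸ isContinuousRep_continuousToLp hT p f⟩
  filter_upwards [isContinuousRep_continuousToLp hT p f, hf, ae_restrict_mem measurableSet_Ioo]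
    with t hΦ hu ht
  rw [← hΦ (Ioo_subset_Icc_self ht), hu]

lemma antilipschitzWith_continuousToLp_top (hT : 0 < T) :
    AntilipschitzWith 1 (continuousToLp (B := B) hT.le ⊤) := fun f g => by
  have hae : ∀ᵐ t ∂timeMeasure T, ∀ ht : t ∈ Icc 0 T, edist (f ⟨t, ht⟩) (g ⟨t, ht⟩) ≤
      edist (continuousToLp hT.le ⊤ f) (continuousToLp hT.le ⊤ g) := by
    filter_upwards [isContinuousRep_continuousToLp hT.le ⊤ f,
      isContinuousRep_continuousToLp hT.le ⊤ g, ae_le_eLpNormEssSup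
        (f := ⇑(continuousToLp hT.le ⊤ f) - ⇑(continuousToLp hT.le ⊤ g))] with t hf hg hle ht
    rw [hf ht, hg ht, edist_eq_enorm_sub, Lp.edist_def]
    exact hle
  rw [ENNReal.coe_one, one_mul, ContinuousMap.edist_eq_iSup]
  exact iSup_le ((dense_of_ae_timeMeasure hT hae).induction (fun x hx => hx x.2)
    (isClosed_le (f.continuous.edist g.continuous) continuous_const))

lemma isClosedEmbedding_continuousToLp_top [CompleteSpace B] (hT : 0 < T) :
    IsClosedEmbedding (continuousToLp (B := B) hT.le ⊤) := by
  obtain ⟨_, hlip⟩ := exists_lipschitzWith_toLp_of_norm_sub_le_dist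
    (memLp_comp_projIcc (B := B) hT.le ⊤) fun f g t => by
      rw [← dist_eq_norm]
      exact ContinuousMap.dist_apply_le_dist _
  exact (antilipschitzWith_continuousToLp_top hT).isClosedEmbedding hlip.uniformContinuous

lemma relativelyCompactInC_of_isCompact_closure [CompleteSpace B] (hT : 0 < T)
    {U : Set (Lp B ⊤ (timeMeasure T))} (hU : IsCompact (closure U))
    (hrep : ∀ u ∈ U, ∃ f : C(Icc (0 : ℝ) T, B), IsContinuousRep u f) :
    RelativelyCompactInC U := by
  refine ⟨hrep, ((isClosedEmbedding_continuousToLp_top hT).isCompact_preimage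
    hU).closure_of_subset ?_⟩
  rintro f ⟨u, hu, hf⟩
  rw [mem_preimage, (isContinuousRep_iff_continuousToLp_eq hT.le).1 hf]
  exact subset_closure hu

variable {Y E : Type*} [NormedSpace ℝ B] [NormedAddCommGroup Y] [NormedSpace ℝ Y]
  [AddCommGroup E] [Module ℝ E] {M : SeminormedCone B} {ιB : B →ₗ[ℝ] E} {ιY : Y →ₗ[ℝ] E}

lemma IsRegularOn.uniformContinuousOn (hcompact : M.CompactlyEmbedded)
    (hlimit : LimitCompatible ιB ιY) {u : ℝ → B} {f : ℝ → ℝ≥0∞} {G : Set ℝ}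
    (hu : IsRegularOn M ιB ιY T u f G) (hf : ∫⁻ x, f x ∂timeMeasure T ≠ ⊤) (K : ℝ≥0) :
    UniformContinuousOn u {t | t ∈ G ∧ ‖M.gauge (u t)‖ₑ ≤ K} := by
  refine EMetric.uniformContinuousOn_iff.2 fun η hη => ?_
  have hη2 : η / 2 ≠ 0 := (ENNReal.half_pos hη.ne').ne'
  obtain ⟨ε, hε, hεη⟩ := ENNReal.exists_nnreal_pos_mul_lt (a := K + K) (by finiteness) hη2
  obtain ⟨C, hE⟩ := hcompact.exists_ehrlingInequality hlimit hε
  obtain ⟨ρ, hρ, hρη⟩ := ENNReal.exists_nnreal_pos_mul_lt (a := C) (by finiteness) hη2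
  obtain ⟨δ, hδ, hsmall⟩ :=
    exists_pos_setLIntegral_lt_of_measure_lt hf (ENNReal.coe_pos.2 hρ).ne'
  refine ⟨δ, hδ, fun {s} hs {t} ht hst => ?_⟩
  have hshort : timeMeasure T (uIoc t s) < δ := by
    refine (Measure.restrict_apply_le _ _).trans_lt ?_
    rwa [Real.volume_uIoc, ← Real.dist_eq, ← edist_dist]
  calc edist (u s) (u t)
      ≤ ε * (‖M.gauge (u s)‖ₑ + ‖M.gauge (u t)‖ₑ) +
          C * ∫⁻ x in uIoc t s, f x ∂timeMeasure T := by
        rw [edist_eq_enorm_sub]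
        exact hu.enorm_sub_le hE ht.1 hs.1
    _ ≤ ε * (K + K) + ρ * C := by
        rw [mul_comm (ρ : ℝ≥0∞)]
        gcongr
        exacts [hs.2, ht.2, (hsmall _ hshort).le]
    _ < η / 2 + η / 2 := ENNReal.add_lt_add hεη hρη
    _ = η := ENNReal.add_halves η

theorem exists_isContinuousRep_of_hasWeakTimeDeriv [CompleteSpace B] [CompleteSpace Y] (hT : 0 < T)
    {r : ℝ≥0∞} (hr : 1 ≤ r) (hcompact : M.CompactlyEmbedded) (hlimit : LimitCompatible ιB ιY)
    {u : Lp B ⊤ (timeMeasure T)} (huM : M.MemLpCone u) {v : Lp Y ⊤ (timeMeasure T)}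
    {v' : Lp Y r (timeMeasure T)} (huv : SameFunction ιB ιY u v) (hv : HasWeakTimeDeriv v v') :
    ∃ f : C(Icc (0 : ℝ) T, B), IsContinuousRep u f := by
  obtain ⟨G, hG⟩ := exists_isRegularOn_of_hasWeakTimeDeriv hT le_top hr huM huv hv
  have hv' : Integrable v' (timeMeasure T) := (Lp.memLp v').integrable hr
  refine exists_isContinuousRep_of_uniformContinuousOn hT ?_
    (hG.uniformContinuousOn hcompact hlimit hv'.hasFiniteIntegral.ne
      (eLpNorm (fun t => M.gauge (u t)) ⊤ (timeMeasure T)).toNNReal)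
  filter_upwards [hG.ae_mem, ae_le_eLpNormEssSup (f := fun t => M.gauge (u t))] with t htG ht
  rw [ENNReal.coe_toNNReal huM.2.eLpNorm_ne_top]
  exact ⟨htG, ht⟩

end ContinuousRepresentatives

end AubinLions

theorem mainTheorem4_general
    {B Y E : Type*}
    [NormedAddCommGroup B] [NormedSpace ℝ B] [CompleteSpace B]
    [NormedAddCommGroup Y] [NormedSpace ℝ Y] [CompleteSpace Y]
    [AddCommGroup E] [Module ℝ E]
    (ιB : B →ₗ[ℝ] E) (ιY : Y →ₗ[ℝ] E)
    (M : AubinLions.SeminormedCone B)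
    (T : ℝ) (hT : 0 < T)
    (p r : ℝ≥0∞) [Fact (1 ≤ p)]
    (hr : 1 ≤ r) (hpr : p = ⊤ → 1 < r)
    (hcompact : M.CompactlyEmbedded)
    (hlimit : AubinLions.LimitCompatible ιB ιY)
    (U : Set (Lp B p (AubinLions.timeMeasure T)))
    (hUM : M.BoundedInLpCone U)
    (hderiv : AubinLions.BoundedTimeDeriv ιB ιY U r) :
    IsCompact (closure U) ∧ (p = ⊤ → AubinLions.RelativelyCompactInC U) := by
  have hU : IsCompact (closure U) :=
    AubinLions.isCompact_closure_of_boundedTimeDeriv hT hr hpr hcompact hlimit hUM hderiv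
  refine ⟨hU, ?_⟩
  rintro rfl
  refine AubinLions.relativelyCompactInC_of_isCompact_closure hT hU fun u hu => ?_
  obtain ⟨_, hM⟩ := hUM
  obtain ⟨_, hD⟩ := hderiv
  obtain ⟨v, huv, v', hv, -⟩ := hD u hu
  exact AubinLions.exists_isContinuousRep_of_hasWeakTimeDeriv hT hr hcompact hlimit (hM u hu).1
    huv hv

theorem mainTheorem4
    {B Y E : Type*}
    [NormedAddCommGroup B] [NormedSpace ℝ B] [CompleteSpace B]
    [NormedAddCommGroup Y] [NormedSpace ℝ Y] [CompleteSpace Y]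
    [AddCommGroup E] [Module ℝ E]
    (ιB : B →ₗ[ℝ] E) (hιB : Function.Injective ιB)
    (ιY : Y →ₗ[ℝ] E) (hιY : Function.Injective ιY)
    (M : AubinLions.SeminormedCone B)
    (T : ℝ) (hT : 0 < T)
    (p r : ℝ≥0∞) [Fact (1 ≤ p)]
    (hpr : (p < ⊤ ∧ r = 1) ∨ (p = ⊤ ∧ 1 < r))
    (hcompact : M.CompactlyEmbedded)
    (hlimit : AubinLions.LimitCompatible ιB ιY)
    (U : Set (Lp B p (AubinLions.timeMeasure T)))
    (hUY : ∀ u ∈ U, ∃ v : Lp Y p (AubinLions.timeMeasure T), AubinLions.SameFunction ιB ιY u v)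
    (hUM : M.BoundedInLpCone U)
    (hderiv : AubinLions.BoundedTimeDeriv ιB ιY U r) :
    IsCompact (closure U) ∧ (p = ⊤ → AubinLions.RelativelyCompactInC U) :=
  mainTheorem4_general ιB ιY M T hT p r (hpr.elim (fun h => h.2.ge) fun h => h.2.le)
    (fun hp => hpr.elim (fun h => absurd hp h.1.ne) And.right) hcompact hlimit U hUM hderiv
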